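/- A board is a finite set $B\subset\mathbb Z^2$ of pixels, adjacent when they share a side; its regions are its connected components. Row (column) segments are the maximal sets of consecutive pixels of $B$ in a row (column). For a pixel $p$, let $p^\ell,p^r,p^u,p^d$ denote the leftmost and rightmost pixel of its row segment and the topmost and bottommost pixel of its column segment. A full tilt move in one of the four directions moves all particles (at most one per pixel) as far as possible in that direction; moreover every sink has a move that removes all particles on it. A board is drainable to a set of sinks if some sequence of moves leads from the fully occupied board to the empty one. In the $k$-scaled board $B^{(k)}$ every pixel, and every sink, is replaced by a $k\times k$ grid of sub-pixels. For a set $S\subseteq B$ of sinks, a solution for $B^{(k)}$ is a set $O$ of sub-pixels (obstacles) such that $B^{(k)}\setminus O$ is drainable to the scaled sinks. The full tilt graph of $B$ has the edges $(p,p^x)$, $x\in\{\ell,r,u,d\}$, $p^x\neq p$. Call a pixel a base vertex if it is reachable in this graph from a pixel at a convex corner of the boundary of $B$, or is a sink $s\in S$ or one of $s^\ell,s^r,s^u,s^d$, or is an end pixel of a row or column segment at a reflex corner of the boundary. The large tilt graph $G_L$ is the subgraph of the full tilt graph induced by all pixels whose row segment and whose column segment both contain a base vertex. The extended graph of $G_L$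 has in addition, for every edge $(p,q)$ of $G_L$ such that $(q,p)$ is not an edge of $G_L$, the inverse edge $(q,p)$ of weight one, and a root $r$ with edges $(s,r)$, $s\in S$; the edges of $G_L$ and the edges $(s,r)$ have weight zero. Let $k>3$. The algorithm, given $B$ and $S\subseteq B$ such that every region of $B$ contains a sink, computes a minimum-weight arborescence $T$ converging to $r$ in the extended graph of $G_L$ and returns the union of the turn gadgets determined by the inverse edges of $T$. The turn gadget of an inverse edge $(q,p)$ consists of three sub-pixels of $p$ in a line perpendicular to the edge: numbering rows and columns of sub-pixels of $p$ by $0,\dots,k-1$, those at positions $0,2,k-1$ in row $1$ if the edge is vertical, and in column $1$ if it is horizontal. Corollary. For every $k>3$, every board $B$ and every $S\subseteq B$ that meets every region of $B$, the algorithm has an output, and every possible output $O$ (for any choice of $T$) satisfies $|O|\le 6\,|O^*|$ for every solution $O^*$ for $B^{(k)}$ with the fewest obstacles. -/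

import Mathlib

/-! Boards, full tilt moves and drainability -/

/-- Pixels of the square tiling, named by integer coordinates. A board is a finite set of pixels;
its edges join the pixels that share a side. -/
abbrev Pixel : Type := ℤ × ℤ

/-- The four directions. -/
inductive Dir : Type
  | left
  | right
  | up
  | down

/-- The unit vector of a direction. -/
def Dir.vec : Dir → Pixel
  | .left => (-1, 0)
  | .right => (1, 0)
  | .up => (0, 1)
  | .down => (0, -1)

/-- The graph of the board `B`: pixels are adjacent when they share a side. -/
def boardGraph (B : Finset Pixel) : SimpleGraph {p : Pixel // p ∈ B} :=
  SimpleGraph.fromRel fun p q => ∃ d : Dir, q.1 = p.1 + d.vec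

/-- Every region (connected component) of `B` contains a pixel of `S`. -/
def EveryRegionHasSink (B S : Finset Pixel) : Prop :=
  ∀ R : (boardGraph B).ConnectedComponent, ∃ s : {p : Pixel // p ∈ B}, s.1 ∈ S ∧ s ∈ R.supp

open scoped Classical in
/-- The pixels strictly ahead of `p` in direction `d`, up to the first pixel outside `B`. -/
noncomputable def ahead (B : Finset Pixel) (d : Dir) (p : Pixel) : Finset Pixel :=
  B.filter fun q => ∃ n : ℕ, 1 ≤ n ∧ q = p + n • d.vec ∧
    ∀ m : ℕ, 1 ≤ m → m ≤ n → p + m • d.vec ∈ B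

/-- The pixels `p^ℓ`, `p^r`, `p^u`, `p^d`: the last pixel of the row or column segment of `p`
in direction `d`, where a single particle that starts at `p` comes to rest. -/
noncomputable def endPixel (B : Finset Pixel) (d : Dir) (p : Pixel) : Pixel :=
  p + (ahead B d p).card • d.vec

/-- `p` and `q` lie in the same row segment of `B` (for `p ∈ B`). -/
def SameRow (B : Finset Pixel) (p q : Pixel) : Prop :=
  q = p ∨ q ∈ ahead B .left p ∨ q ∈ ahead B .right p

/-- `p` and `q` lie in the same column segment of `B` (for `p ∈ B`). -/
def SameColumn (B : Finset Pixel) (p q : Pixel) : Prop :=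
  q = p ∨ q ∈ ahead B .up p ∨ q ∈ ahead B .down p

/-- The full tilt move in direction `d`, applied to the configuration whose set of occupied pixels
is `C`: every particle advances as far as possible, that is, by the number of unoccupied pixels
ahead of it in its segment, so that the particles of each segment are packed at its end. -/
noncomputable def tilt (B : Finset Pixel) (d : Dir) (C : Finset Pixel) : Finset Pixel :=
  C.image fun p => p + (ahead B d p \ C).card • d.vec

/-- One move on the board `B`. Each member of `Z` is a sink, given by the set of pixels it covers;
the move associated with a sink removes all particles on it. -/
inductive Step (B : Finset Pixel) (Z : Finset (Finset Pixel)) :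
    Finset Pixel → Finset Pixel → Prop
  | tilt (C : Finset Pixel) (d : Dir) : Step B Z C (tilt B d C)
  | remove (C z : Finset Pixel) (hz : z ∈ Z) : Step B Z C (C \ z)

/-- `B` is drainable to the sinks `Z`: some sequence of moves leads from the fully occupied board
to the empty configuration. -/
def Drainable (B : Finset Pixel) (Z : Finset (Finset Pixel)) : Prop :=
  Relation.ReflTransGen (Step B Z) B ∅

/-! Scaling and obstacle placements -/

/-- The `k × k` sub-pixels of the pixel `p`. -/
def block (k : ℕ) (p : Pixel) : Finset Pixel :=
  (Finset.range k ×ˢ Finset.range k).image fun c =>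
    ((k : ℤ) * p.1 + (c.1 : ℤ), (k : ℤ) * p.2 + (c.2 : ℤ))

/-- The `k`-scaled board. -/
def scaledBoard (k : ℕ) (B : Finset Pixel) : Finset Pixel := B.biUnion (block k)

/-- The scaled sinks. -/
def scaledSinks (k : ℕ) (S : Finset Pixel) : Finset (Finset Pixel) := S.image (block k)

/-- `O` is a set of obstacles on the `k`-scaled board of `B` that makes it drainable to the scaled
sinks. -/
def IsSolution (k : ℕ) (B S O : Finset Pixel) : Prop :=
  O ⊆ scaledBoard k B ∧ Drainable (scaledBoard k B \ O) (scaledSinks k S)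

/-- `O` is a solution with the fewest obstacles. -/
def IsOptimumSolution (k : ℕ) (B S O : Finset Pixel) : Prop :=
  IsSolution k B S O ∧ ∀ O' : Finset Pixel, IsSolution k B S O' → O.card ≤ O'.card

/-- An optimum solution always exists, since a board filled with obstacles is drainable. -/
theorem exists_isOptimumSolution (k : ℕ) (B S : Finset Pixel) :
    ∃ O : Finset Pixel, IsOptimumSolution k B S O := by
  have hne : {O : Finset Pixel | IsSolution k B S O}.Nonempty :=
    ⟨scaledBoard k B, Finset.Subset.refl _, by
      rw [Finset.sdiff_self]
      exact Relation.ReflTransGen.refl⟩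
  obtain ⟨O, hO, hmin⟩ :=
    WellFounded.has_min (InvImage.wf Finset.card Nat.lt_wfRel.wf) _ hne
  exact ⟨O, hO, fun O' hO' => not_lt.mp (hmin O' hO')⟩

/-! Full tilt graph and large tilt graph -/

/-- The edges of the full tilt graph of `B` (loops are omitted). -/
def FullTiltEdge (B : Finset Pixel) (p q : Pixel) : Prop :=
  p ∈ B ∧ q ∈ B ∧ p ≠ q ∧ ∃ d : Dir, q = endPixel B d p

/-- `p` is incident to a convex corner of the boundary of `B`. -/
def IsCornerPixel (B : Finset Pixel) (p : Pixel) : Prop :=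
  p ∈ B ∧ (p + Dir.left.vec ∉ B ∨ p + Dir.right.vec ∉ B) ∧
    (p + Dir.up.vec ∉ B ∨ p + Dir.down.vec ∉ B)

/-- The vertices of the small tilt graph: the pixels reachable from corner pixels by full tilt
moves. -/
def IsSmallVertex (B : Finset Pixel) (p : Pixel) : Prop :=
  ∃ c : Pixel, IsCornerPixel B c ∧ Relation.ReflTransGen (FullTiltEdge B) c p

/-- `p` is a pixel of `B` incident to a reflex corner of the boundary of `B`: of the four pixels
around some vertex of `p`, exactly three belong to `B`. -/
def IsReflexPixel (B : Finset Pixel) (p : Pixel) : Prop :=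
  p ∈ B ∧ ∃ h v : Dir, (h = .left ∨ h = .right) ∧ (v = .up ∨ v = .down) ∧
    (({p, p + h.vec, p + v.vec, p + h.vec + v.vec} : Finset Pixel) ∩ B).card = 3

/-- The vertices of the large tilt graph other than those arising from intersections: the vertices
of the small tilt graph, the sinks, the end pixels of the row and column segments containing a
sink, and the end pixels of the row and column segments at a reflex corner. -/
def IsBaseVertex (B S : Finset Pixel) (p : Pixel) : Prop :=
  IsSmallVertex B p ∨ p ∈ S ∨ (∃ s ∈ S, ∃ d : Dir, p = endPixel B d s) ∨
    ∃ q : Pixel, IsReflexPixel B q ∧ ∃ d : Dir, p = endPixel B d q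

open scoped Classical in
/-- The vertex set of the large tilt graph: all pixels on an intersection of a row segment and a
column segment that both contain a base vertex. (Every base vertex of `B` is one of these.) -/
noncomputable def largeVertices (B S : Finset Pixel) : Finset Pixel :=
  B.filter fun p => (∃ a : Pixel, IsBaseVertex B S a ∧ SameRow B p a) ∧
    ∃ b : Pixel, IsBaseVertex B S b ∧ SameColumn B p b

/-- The edges of the large tilt graph, the subgraph of the full tilt graph induced by
`largeVertices B S`. -/
def LargeTiltEdge (B S : Finset Pixel) (p q : Pixel) : Prop :=
  p ∈ largeVertices B S ∧ q ∈ largeVertices B S ∧ FullTiltEdge B p q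

/-! Extended graphs and arborescences -/

/-- `(q, p)` is an inverse edge of the graph with edge relation `E`. -/
def IsInverseEdge (E : Pixel → Pixel → Prop) (q p : Pixel) : Prop :=
  E p q ∧ ¬ E q p

/-- The edges of the extended graph of the graph with edge relation `E` and sinks `S`: all edges
of `E`, all inverse edges, and an edge from every sink to the root, which is `none`. -/
def ExtEdge (E : Pixel → Pixel → Prop) (S : Finset Pixel) : Option Pixel → Option Pixel → Prop
  | some p, some q => E p q ∨ IsInverseEdge E p q
  | some p, none => p ∈ S
  | none, _ => False

open scoped Classical in
/-- The weight of an edge of the extended graph: one for inverse edges, zero for all others. -/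
noncomputable def extWeight (E : Pixel → Pixel → Prop) : Option Pixel × Option Pixel → ℕ
  | (some p, some q) => if IsInverseEdge E p q then 1 else 0
  | _ => 0

/-- `T` is the edge set of an arborescence converging to the root in the extended graph of
`(W, E)`: every vertex other than the root has exactly one outgoing edge in `T`, and following
these edges leads to the root. -/
def IsArborescence (W : Finset Pixel) (E : Pixel → Pixel → Prop) (S : Finset Pixel)
    (T : Finset (Option Pixel × Option Pixel)) : Prop :=
  (∀ a b : Option Pixel, (a, b) ∈ T → ExtEdge E S a b) ∧
  (∀ p ∈ W, ∃! b : Option Pixel, (some p, b) ∈ T) ∧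
  (∀ p ∈ W, Relation.ReflTransGen (fun a b => (a, b) ∈ T) (some p) none) ∧
  (∀ a b : Option Pixel, (a, b) ∈ T → ∃ p ∈ W, a = some p)

/-- `T` is an arborescence of minimum total weight. -/
def IsMinArborescence (W : Finset Pixel) (E : Pixel → Pixel → Prop) (S : Finset Pixel)
    (T : Finset (Option Pixel × Option Pixel)) : Prop :=
  IsArborescence W E S T ∧
    ∀ T' : Finset (Option Pixel × Option Pixel), IsArborescence W E S T' →
      ∑ e ∈ T, extWeight E e ≤ ∑ e ∈ T', extWeight E e

/-! The approximation algorithm -/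

/-- The turn gadget determined by the inverse edge `(q, p)`. Its obstacles are placed at sub-pixels
of the head `p`, perpendicular to the edge: at positions `0`, `2` and `k - 1` of the second row of
sub-pixels if the edge is vertical, of the second column if it is horizontal. (For `k = 3` these
are the two outer positions of the middle row or column.) -/
def turnGadget (k : ℕ) (q p : Pixel) : Finset Pixel :=
  if q.1 = p.1 then
    ({0, 2, (k : ℤ) - 1} : Finset ℤ).image fun i => ((k : ℤ) * p.1 + i, (k : ℤ) * p.2 + 1)
  else
    ({0, 2, (k : ℤ) - 1} : Finset ℤ).image fun i => ((k : ℤ) * p.1 + 1, (k : ℤ) * p.2 + i)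

/-- `O` is a possible output of the algorithm with scaling factor `k` on the board `B` with
sinks `S`: the union of the turn gadgets determined by the inverse edges in some minimum-weight
arborescence of the extended large tilt graph. -/
def IsAlgorithmOutput (k : ℕ) (B S O : Finset Pixel) : Prop :=
  ∃ T : Finset (Option Pixel × Option Pixel),
    IsMinArborescence (largeVertices B S) (LargeTiltEdge B S) S T ∧
    ∀ x : Pixel, x ∈ O ↔ ∃ q p : Pixel, (some q, some p) ∈ T ∧
      IsInverseEdge (LargeTiltEdge B S) q p ∧ x ∈ turnGadget k q p

/-! Directions and segments -/

/-! Every inverse edge costs at most three obstacles (`card_gadgetUnion_le`), so it suffices to turn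
an arbitrary solution `O` into an arborescence of weight at most `2 * O.card`
(`exists_arborescence_of_isSolution`). Minimality of the arborescence used by the algorithm then
gives the factor 6.

An obstacle lies in one row segment and one column segment of `B`. A segment without base vertices
has neither a wall nor a reflex corner beside it, so its translate by one pixel is again a segment
(`endPixel_add_of_not_isBaseVertex`). Translating on in a fixed direction leads to a segment with a
base vertex (`roundTo`), and one end of that segment, `segRep`, represents the original one. Let `Q`
be the set of representatives of all segments with obstacles, at most two per obstacle. Since each
vertex has a single outgoing edge in an arborescence, weight at most `Q.card` is achieved once every
vertex reaches the root by zero-weight edges and inverse edges leaving `Q` (`exists_arborescence`).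

Such connections imitate the path of a single particle to a sink on the drainable scaled board
(`Drainable.exists_path`, `reach_of_path`). A move stays within one segment of `B` and stops in its
end pixel or at an obstacle (`coarse_endPixel`). In the first case the next turn is imitated by
tilts, in the second by an inverse edge leaving `Q` (`Avail.reach_perp`). A pixel completely covered
by obstacles has no particle to follow, but both its representatives lie in `Q`, so one can walk
through its region to an uncovered pixel or a sink (`reach_segRep_none`). -/

/-- The opposite direction. -/
def Dir.opp : Dir → Dir
  | .left => .right
  | .right => .left
  | .up => .down
  | .down => .up

/-- The two directions are perpendicular. -/
def Dir.Perp : Dir → Dir → Prop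
  | .left, .up | .left, .down | .right, .up | .right, .down => True
  | .up, .left | .up, .right | .down, .left | .down, .right => True
  | _, _ => False

theorem Dir.Perp.symm {d e : Dir} (h : d.Perp e) : e.Perp d := by
  cases d <;> cases e <;> simp_all [Dir.Perp]

theorem Dir.Perp.opp_left {d e : Dir} (h : d.Perp e) : d.opp.Perp e := by
  cases d <;> cases e <;> simp_all [Dir.Perp, Dir.opp]

theorem Dir.opp_opp (d : Dir) : d.opp.opp = d := by cases d <;> rfl

theorem Dir.vec_opp (d : Dir) : d.opp.vec = -d.vec := by cases d <;> simp [Dir.opp, Dir.vec]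

theorem Dir.eq_or_opp_or_perp (d e : Dir) : e = d ∨ e = d.opp ∨ d.Perp e := by
  cases d <;> cases e <;> simp [Dir.Perp, Dir.opp]

theorem Dir.Perp.eq_or_opp {d e x : Dir} (h : d.Perp e) (hx : d.Perp x) : x = e ∨ x = e.opp := by
  cases d <;> cases e <;> cases x <;> simp_all [Dir.Perp, Dir.opp]

theorem Dir.add_nsmul_vec_ne (d : Dir) (p : Pixel) {n : ℕ} (hn : n ≠ 0) : p + n • d.vec ≠ p := by
  cases d <;> simp [Dir.vec, Prod.ext_iff, hn]

theorem Dir.vec_ne_zero (d : Dir) : d.vec ≠ 0 := by cases d <;> simp [Dir.vec]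

theorem Dir.Perp.vec_add_vec_ne_zero {d e : Dir} (h : d.Perp e) : d.vec + e.vec ≠ 0 := by
  cases d <;> cases e <;> simp_all [Dir.Perp, Dir.vec]

theorem Dir.Perp.horizontal_vertical {d e : Dir} (h : d.Perp e) :
    (d = .left ∨ d = .right) ∧ (e = .up ∨ e = .down) ∨
      (e = .left ∨ e = .right) ∧ (d = .up ∨ d = .down) := by
  cases d <;> cases e <;> simp_all [Dir.Perp]

/-! ### Recursion along segments, and their end pixels. -/

theorem ahead_of_notMem {B : Finset Pixel} {d : Dir} {p : Pixel} (h : p + d.vec ∉ B) :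
    ahead B d p = ∅ := by
  classical
  ext q
  simp only [ahead, Finset.mem_filter, Finset.notMem_empty, iff_false]
  rintro ⟨-, n, hn, -, hm⟩
  exact h (by simpa using hm 1 le_rfl hn)

theorem ahead_of_mem {B : Finset Pixel} {d : Dir} {p : Pixel} (h : p + d.vec ∈ B) :
    ahead B d p = insert (p + d.vec) (ahead B d (p + d.vec)) := by
  classical
  have key : ∀ m : ℕ, p + d.vec + m • d.vec = p + (m + 1) • d.vec := fun m => by
    rw [succ_nsmul]; abel
  ext q
  simp only [ahead, Finset.mem_filter, Finset.mem_insert]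
  constructor
  · rintro ⟨hq, n, hn, rfl, hm⟩
    obtain ⟨n, rfl⟩ := Nat.exists_eq_add_of_le' hn
    rcases Nat.eq_zero_or_pos n with rfl | hpos
    · left; simp
    · right
      refine ⟨hq, n, hpos, (key n).symm, fun m _ h2 => ?_⟩
      rw [key]
      exact hm _ (by omega) (by omega)
  · rintro (rfl | ⟨hq, n, hn, rfl, hm⟩)
    · refine ⟨h, 1, le_rfl, by simp, fun m h1 h2 => ?_⟩
      obtain rfl : m = 1 := by omega
      simpa using h
    · refine ⟨hq, n + 1, by omega, key n, fun m h1 h2 => ?_⟩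
      obtain ⟨m, rfl⟩ := Nat.exists_eq_add_of_le' h1
      rcases Nat.eq_zero_or_pos m with rfl | hpos
      · simpa using h
      · rw [← key]; exact hm m hpos (by omega)

theorem notMem_ahead_self (B : Finset Pixel) (d : Dir) (p : Pixel) : p ∉ ahead B d p := by
  classical
  simp only [ahead, Finset.mem_filter, not_and, not_exists]
  intro _ n hn h
  exact (d.add_nsmul_vec_ne p (by omega) h.symm).elim

theorem card_ahead_of_mem {B : Finset Pixel} {d : Dir} {p : Pixel} (h : p + d.vec ∈ B) :
    (ahead B d p).card = (ahead B d (p + d.vec)).card + 1 := by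
  rw [ahead_of_mem h, Finset.card_insert_of_notMem (notMem_ahead_self _ _ _)]

theorem endPixel_of_notMem {B : Finset Pixel} {d : Dir} {p : Pixel} (h : p + d.vec ∉ B) :
    endPixel B d p = p := by
  simp [endPixel, ahead_of_notMem h]

theorem endPixel_of_mem {B : Finset Pixel} {d : Dir} {p : Pixel} (h : p + d.vec ∈ B) :
    endPixel B d (p + d.vec) = endPixel B d p := by
  rw [endPixel, endPixel, card_ahead_of_mem h, succ_nsmul]
  abel

/-- Induction along the segments of `B`, starting from their ends in direction `d`. -/
theorem segment_induction {B : Finset Pixel} (d : Dir) {P : Pixel → Prop}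
    (last : ∀ p ∈ B, p + d.vec ∉ B → P p)
    (step : ∀ p ∈ B, p + d.vec ∈ B → P (p + d.vec) → P p) : ∀ p ∈ B, P p := by
  suffices H : ∀ n : ℕ, ∀ p ∈ B, (ahead B d p).card = n → P p from fun p hp => H _ p hp rfl
  intro n
  induction n with
  | zero =>
    intro p hp h0
    refine last p hp fun h => ?_
    rw [card_ahead_of_mem h] at h0
    omega
  | succ n ih =>
    intro p hp hn
    by_cases h : p + d.vec ∈ B
    · refine step p hp h (ih _ h ?_)
      rw [card_ahead_of_mem h] at hn
      omega
    · exact last p hp h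

theorem endPixel_mem {B : Finset Pixel} (d : Dir) : ∀ p ∈ B, endPixel B d p ∈ B := by
  refine segment_induction d (fun p hp h => ?_) fun p hp h ih => ?_
  · rwa [endPixel_of_notMem h]
  · rwa [← endPixel_of_mem h]

theorem endPixel_add_notMem {B : Finset Pixel} (d : Dir) :
    ∀ p ∈ B, endPixel B d p + d.vec ∉ B := by
  refine segment_induction d (fun p hp h => ?_) fun p hp h ih => ?_
  · rwa [endPixel_of_notMem h]
  · rwa [← endPixel_of_mem h]

theorem endPixel_endPixel {B : Finset Pixel} (d : Dir) {p : Pixel} (hp : p ∈ B) :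
    endPixel B d (endPixel B d p) = endPixel B d p :=
  endPixel_of_notMem (endPixel_add_notMem d p hp)

theorem endPixel_opp_add {B : Finset Pixel} {d : Dir} {p : Pixel} (hp : p ∈ B) :
    endPixel B d.opp (p + d.vec) = endPixel B d.opp p := by
  have h : p + d.vec + d.opp.vec = p := by rw [Dir.vec_opp]; abel
  have := endPixel_of_mem (B := B) (d := d.opp) (p := p + d.vec) (by rwa [h])
  rw [h] at this
  exact this.symm

theorem endPixel_opp_endPixel {B : Finset Pixel} (d : Dir) :
    ∀ p ∈ B, endPixel B d.opp (endPixel B d p) = endPixel B d.opp p := by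
  refine segment_induction d (fun p hp h => ?_) fun p hp h ih => ?_
  · rw [endPixel_of_notMem h]
  · rw [← endPixel_of_mem h, ih, endPixel_opp_add hp]

/-- Pixels of the same segment have the same ends. -/
theorem endPixel_add_of_parallel {B : Finset Pixel} {d x : Dir} (hx : x = d ∨ x = d.opp)
    {p : Pixel} (hp : p ∈ B) (hpx : p + x.vec ∈ B) :
    endPixel B d (p + x.vec) = endPixel B d p := by
  rcases hx with rfl | rfl
  · exact endPixel_of_mem hpx
  · have := endPixel_opp_add (d := d.opp) hp
    rwa [Dir.opp_opp] at this

theorem endPixel_endPixel_of_parallel {B : Finset Pixel} {d x : Dir} (hx : x = d ∨ x = d.opp)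
    {p : Pixel} (hp : p ∈ B) : endPixel B d (endPixel B x p) = endPixel B d p := by
  rcases hx with rfl | rfl
  · exact endPixel_endPixel _ hp
  · have := endPixel_opp_endPixel d.opp p hp
    rwa [Dir.opp_opp] at this

theorem mem_of_mem_ahead {B : Finset Pixel} {d : Dir} {p q : Pixel} (h : q ∈ ahead B d p) :
    q ∈ B := by
  classical
  exact (Finset.mem_filter.1 h).1

theorem endPixel_of_mem_ahead {B : Finset Pixel} (d : Dir) : ∀ p ∈ B, ∀ q ∈ ahead B d p,
    endPixel B d q = endPixel B d p ∧ endPixel B d.opp q = endPixel B d.opp p ∧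
      (ahead B d q).card < (ahead B d p).card := by
  refine segment_induction d (fun p hp h => ?_) fun p hp h ih => ?_
  · simp [ahead_of_notMem h]
  · intro q hq
    rw [ahead_of_mem h, Finset.mem_insert] at hq
    rw [card_ahead_of_mem h, ← endPixel_of_mem h, ← endPixel_opp_add hp]
    rcases hq with rfl | hq
    · simp
    · obtain ⟨h1, h2, h3⟩ := ih q hq
      exact ⟨h1, h2, by omega⟩

theorem endPixel_eq_or_mem_ahead {B : Finset Pixel} (d : Dir) : ∀ p ∈ B,
    endPixel B d p = p ∨ endPixel B d p ∈ ahead B d p := by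
  refine segment_induction d (fun p hp h => ?_) fun p hp h ih => ?_
  · exact Or.inl (endPixel_of_notMem h)
  · right
    rw [ahead_of_mem h, ← endPixel_of_mem h, Finset.mem_insert]
    exact ih

/-! Drainable boards -/

/-- The foremost particle of a segment has only free pixels ahead and moves to the very end. It need
not be the particle at `p`, but only occupancy matters. -/
theorem endPixel_mem_tilt {B C : Finset Pixel} (d : Dir) {p : Pixel} (hp : p ∈ B) (hpC : p ∈ C) :
    endPixel B d p ∈ tilt B d C := by
  induction hn : (ahead B d p).card using Nat.strong_induction_on generalizing p with
  | _ n ih =>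
    by_cases h : ∃ q ∈ ahead B d p, q ∈ C
    · obtain ⟨q, hq, hqC⟩ := h
      obtain ⟨h1, -, h3⟩ := endPixel_of_mem_ahead d p hp q hq
      rw [← h1]
      exact ih _ (hn ▸ h3) (mem_of_mem_ahead hq) hqC rfl
    · push Not at h
      refine Finset.mem_image.2 ⟨p, hpC, ?_⟩
      rw [Finset.sdiff_eq_self_of_disjoint (Finset.disjoint_left.2 h)]
      rfl

/-- On a drainable board every pixel is connected to a sink by full tilt moves of a single
particle. -/
theorem Drainable.exists_path {B : Finset Pixel} {Z : Finset (Finset Pixel)} (h : Drainable B Z)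
    {p : Pixel} (hp : p ∈ B) : ∃ z ∈ Z, ∃ q ∈ z,
      Relation.ReflTransGen (fun a b => a ∈ B ∧ ∃ d : Dir, b = endPixel B d a) p q := by
  by_contra hcon
  set Stuck : Pixel → Prop := fun p => p ∈ B ∧ ¬ ∃ z ∈ Z, ∃ q ∈ z,
    Relation.ReflTransGen (fun a b => a ∈ B ∧ ∃ d : Dir, b = endPixel B d a) p q
  -- Invariant: some occupied pixel cannot reach a sink. A tilt preserves it because the end of the
  -- segment becomes occupied, a removal because the pixel is not on a sink.
  suffices H : ∀ C, Relation.ReflTransGen (Step B Z) B C → ∃ p ∈ C, Stuck p by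
    obtain ⟨p, hp, -⟩ := H ∅ h
    simp at hp
  intro C hC
  induction hC with
  | refl => exact ⟨p, hp, hp, hcon⟩
  | tail _ hs ih =>
    obtain ⟨p, hpC, hpB, hps⟩ := ih
    cases hs with
    | tilt d =>
      refine ⟨_, endPixel_mem_tilt d hpB hpC, endPixel_mem d p hpB, ?_⟩
      rintro ⟨z, hz, q, hq, hr⟩
      exact hps ⟨z, hz, q, hq, .head ⟨hpB, d, rfl⟩ hr⟩
    | remove z hz =>
      refine ⟨p, Finset.mem_sdiff.2 ⟨hpC, fun h => ?_⟩, hpB, hps⟩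
      exact hps ⟨z, hz, p, h, .refl⟩

/-! Base vertices -/

section Base

variable {B S : Finset Pixel}

theorem isCornerPixel_of_perp {d e : Dir} (h : d.Perp e) {p : Pixel} (hp : p ∈ B)
    (hd : p + d.vec ∉ B) (he : p + e.vec ∉ B) : IsCornerPixel B p := by
  cases d <;> cases e <;> simp_all [Dir.Perp, IsCornerPixel]

theorem isReflexPixel_of_perp {d e : Dir} (h : d.Perp e) {p : Pixel} (hp : p ∈ B)
    (hde : p + d.vec + e.vec ∈ B)
    (hx : p + d.vec ∈ B ∧ p + e.vec ∉ B ∨ p + d.vec ∉ B ∧ p + e.vec ∈ B) :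
    IsReflexPixel B p := by
  have hde' : p + e.vec + d.vec ∈ B := by rwa [add_right_comm]
  have key : ∀ h v : Dir, h.Perp v → p + h.vec + v.vec ∈ B →
      (p + h.vec ∈ B ∧ p + v.vec ∉ B ∨ p + h.vec ∉ B ∧ p + v.vec ∈ B) →
      (({p, p + h.vec, p + v.vec, p + h.vec + v.vec} : Finset Pixel) ∩ B).card = 3 := by
    rintro h v hp' h1 (⟨h2, h3⟩ | ⟨h2, h3⟩)
    · rw [Finset.insert_inter_of_mem hp, Finset.insert_inter_of_mem h2,
        Finset.insert_inter_of_notMem h3, Finset.singleton_inter_of_mem h1]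
      refine Finset.card_eq_three.2 ⟨_, _, _, ?_, ?_, ?_, rfl⟩
      · simpa using h.vec_ne_zero
      · simpa [add_assoc] using hp'.vec_add_vec_ne_zero
      · simpa using v.vec_ne_zero
    · rw [Finset.insert_inter_of_mem hp, Finset.insert_inter_of_notMem h2,
        Finset.insert_inter_of_mem h3, Finset.singleton_inter_of_mem h1]
      refine Finset.card_eq_three.2 ⟨_, _, _, ?_, ?_, ?_, rfl⟩
      · simpa using v.vec_ne_zero
      · simpa [add_assoc] using hp'.vec_add_vec_ne_zero
      · simpa [add_right_comm] using h.vec_ne_zero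
  rcases h.horizontal_vertical with ⟨h1, h2⟩ | ⟨h1, h2⟩
  · exact ⟨hp, d, e, h1, h2, key d e h hde hx⟩
  · exact ⟨hp, e, d, h1, h2, key e d h.symm hde' (by tauto)⟩

/-- Tilting along a wall ends in a base vertex. -/
theorem isBaseVertex_endPixel_of_wall {d e : Dir} (h : d.Perp e) :
    ∀ p ∈ B, p + e.vec ∉ B → IsBaseVertex B S (endPixel B d p) := by
  refine segment_induction d (fun p hp hd he => ?_) fun p hp hd ih he => ?_
  · rw [endPixel_of_notMem hd]
    exact Or.inl ⟨p, isCornerPixel_of_perp h hp hd he, .refl⟩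
  -- If the wall ends here, there is a reflex corner at `p`; if it never ends, the segment ends in a
  -- convex corner.
  · by_cases hde : p + d.vec + e.vec ∈ B
    · exact Or.inr <| Or.inr <| Or.inr
        ⟨p, isReflexPixel_of_perp h hp hde (Or.inl ⟨hd, he⟩), d, rfl⟩
    · rw [← endPixel_of_mem hd]
      exact ih hde

theorem IsBaseVertex.mem (hSB : S ⊆ B) {p : Pixel} (h : IsBaseVertex B S p) : p ∈ B := by
  rcases h with ⟨c, hc, hr⟩ | h | ⟨s, hs, d, rfl⟩ | ⟨q, hq, d, rfl⟩
  · rcases hr.cases_tail with rfl | ⟨_, _, h⟩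
    · exact hc.1
    · exact h.2.1
  · exact hSB h
  · exact endPixel_mem d s (hSB hs)
  · exact endPixel_mem d q hq.1

/-- Base vertices are closed under tilts. The definition closes only the small vertices; an end
pixel of another kind has a wall in front of it, and a perpendicular tilt runs along that wall. -/
theorem IsBaseVertex.endPixel (hSB : S ⊆ B) {p : Pixel} (h : IsBaseVertex B S p) (d : Dir) :
    IsBaseVertex B S (endPixel B d p) := by
  have hp := h.mem hSB
  have key : ∀ q ∈ B, ∀ x : Dir, p = _root_.endPixel B x q →
      IsBaseVertex B S (_root_.endPixel B d q) → IsBaseVertex B S (_root_.endPixel B d p) := by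
    rintro q hq x rfl hb
    by_cases hx : x = d ∨ x = d.opp
    · rwa [endPixel_endPixel_of_parallel hx hq]
    · have hperp : d.Perp x := by have := d.eq_or_opp_or_perp x; tauto
      exact isBaseVertex_endPixel_of_wall hperp _ hp (endPixel_add_notMem x q hq)
  rcases h with ⟨c, hc, hr⟩ | h | ⟨s, hs, x, hx⟩ | ⟨q, hq, x, hx⟩
  · refine Or.inl ⟨c, hc, ?_⟩
    by_cases heq : p = _root_.endPixel B d p
    · rwa [← heq]
    · exact hr.tail ⟨hp, endPixel_mem d p hp, heq, d, rfl⟩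
  · exact Or.inr <| Or.inr <| Or.inl ⟨p, h, d, rfl⟩
  · exact key s (hSB hs) x hx (Or.inr <| Or.inr <| Or.inl ⟨s, hs, d, rfl⟩)
  · exact key q hq.1 x hx (Or.inr <| Or.inr <| Or.inr ⟨q, hq, d, rfl⟩)

theorem isBaseVertex_endPixel_of_parallel (hSB : S ⊆ B) {d x : Dir} (hx : x = d ∨ x = d.opp)
    {p : Pixel} (hp : p ∈ B) (h : IsBaseVertex B S (endPixel B x p)) :
    IsBaseVertex B S (endPixel B d p) := by
  have := h.endPixel hSB d
  rwa [endPixel_endPixel_of_parallel hx hp] at this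

/-- A pixel is a vertex of the large tilt graph exactly if its segments end in base vertices. -/
theorem mem_largeVertices_iff (hSB : S ⊆ B) {d e : Dir} (hde : d.Perp e) {p : Pixel} :
    p ∈ largeVertices B S ↔ p ∈ B ∧ IsBaseVertex B S (endPixel B d p) ∧
      IsBaseVertex B S (endPixel B e p) := by
  classical
  -- By closure under tilts, a base vertex anywhere in a segment makes its ends base vertices.
  have seg : ∀ x y : Dir, y = x.opp → p ∈ B →
      ((∃ a, IsBaseVertex B S a ∧ (a = p ∨ a ∈ ahead B x p ∨ a ∈ ahead B y p)) ↔
        IsBaseVertex B S (endPixel B x p)) := by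
    rintro x y rfl hp
    constructor
    · rintro ⟨a, ha, rfl | h | h⟩
      · exact ha.endPixel hSB x
      · rw [← (endPixel_of_mem_ahead x p hp a h).1]
        exact ha.endPixel hSB x
      · have := (endPixel_of_mem_ahead x.opp p hp a h).2.1
        rw [Dir.opp_opp] at this
        rw [← this]
        exact ha.endPixel hSB x
    · intro h
      refine ⟨_, h, ?_⟩
      have := endPixel_eq_or_mem_ahead x p hp
      tauto
  have par : ∀ x : Dir, p ∈ B → (IsBaseVertex B S (endPixel B x.opp p) ↔
      IsBaseVertex B S (endPixel B x p)) := fun x hp =>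
    ⟨isBaseVertex_endPixel_of_parallel hSB (Or.inr rfl) hp,
      isBaseVertex_endPixel_of_parallel hSB (Or.inr x.opp_opp.symm) hp⟩
  rw [largeVertices, Finset.mem_filter]
  refine and_congr_right fun hp => ?_
  have h1 := seg .left .right rfl hp
  have h2 := seg .up .down rfl hp
  have h3 := par .left hp
  have h4 := par .up hp
  simp only [SameRow, SameColumn]
  rw [h1, h2]
  simp only [Dir.opp] at h3 h4
  cases d <;> cases e <;> simp_all [Dir.Perp, and_comm]

theorem IsBaseVertex.mem_largeVertices (hSB : S ⊆ B) {p : Pixel} (h : IsBaseVertex B S p) :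
    p ∈ largeVertices B S :=
  (mem_largeVertices_iff hSB (d := .left) (e := .up) trivial).2
    ⟨h.mem hSB, h.endPixel hSB _, h.endPixel hSB _⟩

/-- A segment without base vertices has all its translates by one pixel in the board. -/
theorem add_mem_of_not_isBaseVertex {d e : Dir} (h : d.Perp e) {p : Pixel} (hp : p ∈ B)
    (hb : ¬ IsBaseVertex B S (endPixel B d p)) : p + e.vec ∈ B := by
  by_contra he
  exact hb (isBaseVertex_endPixel_of_wall h p hp he)

/-- The translate of a segment without base vertices is a segment. -/
theorem endPixel_add_of_not_isBaseVertex {d e : Dir} (h : d.Perp e) :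
    ∀ p ∈ B, ¬ IsBaseVertex B S (endPixel B d p) →
      endPixel B d (p + e.vec) = endPixel B d p + e.vec := by
  refine segment_induction d (fun p hp hd hb => ?_) fun p hp hd ih hb => ?_
  · have he := add_mem_of_not_isBaseVertex h hp hb
    rw [endPixel_of_notMem hd, endPixel_of_notMem]
    -- Otherwise the translate would extend beyond the end of the segment, creating a reflex corner
    -- there.
    intro hde
    rw [add_right_comm] at hde
    exact hb (Or.inr <| Or.inr <| Or.inr
      ⟨p, isReflexPixel_of_perp h hp hde (Or.inr ⟨hd, he⟩), d, rfl⟩)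
  · rw [← endPixel_of_mem hd] at hb ⊢
    have := add_mem_of_not_isBaseVertex h hd hb
    rw [← ih hb, add_right_comm, endPixel_of_mem (by rwa [add_right_comm])]

/-! Rounding to segments with base vertices -/

variable (B S)

open scoped Classical in
/-- The first pixel from `p` on in direction `e` whose segment in direction `d` contains a base
vertex. -/
noncomputable def roundTo (d e : Dir) (p : Pixel) : Pixel :=
  if _h : IsBaseVertex B S (endPixel B d p) ∨ p + e.vec ∉ B then p
  else roundTo d e (p + e.vec)
termination_by (ahead B e p).card
decreasing_by
  push Not at _h
  rw [card_ahead_of_mem _h.2]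
  omega

/-- The vertex of the large tilt graph that represents the segment of `p` in direction `d`. -/
noncomputable def segRep (d e : Dir) (p : Pixel) : Pixel := endPixel B d (roundTo B S d e p)

variable {B S}

theorem roundTo_of_isBaseVertex {d e : Dir} {p : Pixel} (h : IsBaseVertex B S (endPixel B d p)) :
    roundTo B S d e p = p := by
  rw [roundTo, dif_pos (Or.inl h)]

theorem roundTo_of_not_isBaseVertex {d e : Dir} (hde : d.Perp e) {p : Pixel} (hp : p ∈ B)
    (h : ¬ IsBaseVertex B S (endPixel B d p)) :
    roundTo B S d e p = roundTo B S d e (p + e.vec) := by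
  have := add_mem_of_not_isBaseVertex hde hp h
  rw [roundTo, dif_neg]
  tauto

/-- Induction along the translates of a segment up to one that contains a base vertex. -/
theorem roundTo_induction {d e : Dir} (hde : d.Perp e) {P : Pixel → Prop}
    (base : ∀ p ∈ B, IsBaseVertex B S (endPixel B d p) → P p)
    (step : ∀ p ∈ B, ¬ IsBaseVertex B S (endPixel B d p) → p + e.vec ∈ B → P (p + e.vec) → P p) :
    ∀ p ∈ B, P p := by
  refine segment_induction e (fun p hp he => ?_) fun p hp he ih => ?_
  · exact base p hp (isBaseVertex_endPixel_of_wall hde p hp he)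
  · by_cases h : IsBaseVertex B S (endPixel B d p)
    · exact base p hp h
    · exact step p hp h he ih

/-- The last conjunct says that rounding moves a pixel only within its own perpendicular segment;
this allows a turn at `p` to be made at the rounded pixel instead. -/
theorem roundTo_spec {d e : Dir} (hde : d.Perp e) : ∀ p ∈ B, roundTo B S d e p ∈ B ∧
    IsBaseVertex B S (endPixel B d (roundTo B S d e p)) ∧
      endPixel B e (roundTo B S d e p) = endPixel B e p := by
  refine roundTo_induction (S := S) hde (fun p hp h => ?_) fun p hp h he ih => ?_
  · rw [roundTo_of_isBaseVertex h]
    exact ⟨hp, h, rfl⟩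
  · rw [roundTo_of_not_isBaseVertex hde hp h]
    rwa [endPixel_of_mem he] at ih

/-- The pixels of a segment are translated in step, so rounding takes ends to ends. -/
theorem endPixel_roundTo (hSB : S ⊆ B) {d e x : Dir} (hde : d.Perp e) (hx : x = d ∨ x = d.opp) :
    ∀ p ∈ B, endPixel B x (roundTo B S d e p) = roundTo B S d e (endPixel B x p) := by
  have hxd : d = x ∨ d = x.opp := by
    rcases hx with rfl | rfl
    · exact Or.inl rfl
    · exact Or.inr d.opp_opp.symm
  have hxe : x.Perp e := by
    rcases hx with rfl | rfl
    · exact hde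
    · exact hde.opp_left
  refine roundTo_induction (S := S) hde (fun p hp h => ?_) fun p hp h he ih => ?_
  · rw [roundTo_of_isBaseVertex h, roundTo_of_isBaseVertex]
    rwa [endPixel_endPixel_of_parallel hx hp]
  · have hb : ¬ IsBaseVertex B S (endPixel B x p) := fun hb =>
      h (isBaseVertex_endPixel_of_parallel hSB hx hp hb)
    rw [roundTo_of_not_isBaseVertex hde hp h, ih, endPixel_add_of_not_isBaseVertex hxe p hp hb,
      roundTo_of_not_isBaseVertex hde (endPixel_mem x p hp)]
    rwa [endPixel_endPixel_of_parallel hx hp]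

theorem segRep_eq (hSB : S ⊆ B) {d e : Dir} (hde : d.Perp e) {p : Pixel} (hp : p ∈ B) :
    segRep B S d e p = roundTo B S d e (endPixel B d p) :=
  endPixel_roundTo hSB hde (Or.inl rfl) p hp

/-- The representative depends on the segment only. -/
theorem segRep_congr (hSB : S ⊆ B) {d e : Dir} (hde : d.Perp e) {p q : Pixel} (hp : p ∈ B)
    (hq : q ∈ B) (h : endPixel B d p = endPixel B d q) :
    segRep B S d e p = segRep B S d e q := by
  rw [segRep_eq hSB hde hp, segRep_eq hSB hde hq, h]

theorem isBaseVertex_segRep {d e : Dir} (hde : d.Perp e) {p : Pixel} (hp : p ∈ B) :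
    IsBaseVertex B S (segRep B S d e p) := (roundTo_spec hde p hp).2.1

theorem segRep_of_mem_largeVertices (hSB : S ⊆ B) {d e : Dir} (hde : d.Perp e) {p : Pixel}
    (hp : p ∈ largeVertices B S) : segRep B S d e p = endPixel B d p := by
  rw [segRep, roundTo_of_isBaseVertex ((mem_largeVertices_iff hSB hde).1 hp).2.1]

/-! Reachability in the extended graph -/

/-- The edges of the extended large tilt graph all of whose inverse edges start in `Q`. -/
def ReachEdge (B S Q : Finset Pixel) (a b : Option Pixel) : Prop :=
  ExtEdge (LargeTiltEdge B S) S a b ∧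
    ∀ p q : Pixel, a = some p → b = some q → LargeTiltEdge B S p q ∨ p ∈ Q

/-- Connection of vertices in the extended large tilt graph by zero-weight edges and inverse edges
that start in `Q`. -/
abbrev Reach (B S Q : Finset Pixel) (p : Pixel) (b : Option Pixel) : Prop :=
  Relation.ReflTransGen (ReachEdge B S Q) (some p) b

variable {Q : Finset Pixel}

theorem reach_endPixel {p : Pixel} (d : Dir) (hp : p ∈ largeVertices B S)
    (hq : endPixel B d p ∈ largeVertices B S) : Reach B S Q p (some (endPixel B d p)) := by
  classical
  by_cases h : p = endPixel B d p
  · rw [← h]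
  · have hE : LargeTiltEdge B S p (endPixel B d p) :=
      ⟨hp, hq, (Finset.mem_filter.1 hp).1, (Finset.mem_filter.1 hq).1, h, d, rfl⟩
    refine .single ⟨Or.inl hE, ?_⟩
    rintro _ _ ⟨⟩ ⟨⟩
    exact Or.inl hE

/-- Going back from an end pixel is free if it is itself a tilt; otherwise it is an inverse edge,
allowed because it leaves `Q`. -/
theorem reach_of_endPixel {p : Pixel} (d : Dir) (hp : p ∈ largeVertices B S)
    (hq : endPixel B d p ∈ largeVertices B S) (hQ : endPixel B d p ∈ Q) :
    Reach B S Q (endPixel B d p) (some p) := by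
  classical
  by_cases h : p = endPixel B d p
  · rw [← h]
  · have hE : LargeTiltEdge B S p (endPixel B d p) :=
      ⟨hp, hq, (Finset.mem_filter.1 hp).1, (Finset.mem_filter.1 hq).1, h, d, rfl⟩
    refine .single ⟨?_, ?_⟩
    · by_cases hE' : LargeTiltEdge B S (endPixel B d p) p
      · exact Or.inl hE'
      · exact Or.inr ⟨hE, hE'⟩
    · rintro _ _ ⟨⟩ ⟨⟩
      exact Or.inr hQ

theorem reach_segRep (hSB : S ⊆ B) {d e : Dir} (hde : d.Perp e) {p : Pixel}
    (hp : p ∈ largeVertices B S) : Reach B S Q p (some (segRep B S d e p)) := by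
  have hb := isBaseVertex_segRep (S := S) hde ((mem_largeVertices_iff hSB hde).1 hp).1
  rw [segRep_of_mem_largeVertices hSB hde hp] at hb ⊢
  exact reach_endPixel d hp (hb.mem_largeVertices hSB)

theorem reach_none {s : Pixel} (hs : s ∈ S) : Reach B S Q s none :=
  .single ⟨hs, by rintro _ _ - ⟨⟩⟩

/-- `p` is an end of its segment in direction `d`, or inverse edges can be used in this segment. -/
def Avail (B S Q : Finset Pixel) (d e : Dir) (p : Pixel) : Prop :=
  (∃ x : Dir, (x = d ∨ x = d.opp) ∧ endPixel B x p = p) ∨ segRep B S d e p ∈ Q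

/-- Turning into the perpendicular segment at an available pixel. -/
theorem Avail.reach_perp (hSB : S ⊆ B) {d e : Dir} (hde : d.Perp e) {p : Pixel} (hp : p ∈ B)
    (h : Avail B S Q d e p) :
    Reach B S Q (segRep B S d e p) (some (segRep B S e d p)) := by
  obtain ⟨hy, hb, he⟩ := roundTo_spec (S := S) hde p hp
  have hrep := (isBaseVertex_segRep (S := S) hde hp)
  have hrepL := hrep.mem_largeVertices hSB
  rcases h with ⟨x, hx, hxp⟩ | hQ
  · have h1 := endPixel_roundTo hSB hde hx p hp
    rw [hxp] at h1
    have h2 : endPixel B x (segRep B S d e p) = roundTo B S d e p := by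
      rw [segRep]
      rcases hx with rfl | rfl
      · rw [h1, h1]
      · rw [endPixel_opp_endPixel d _ hy, h1]
    have hyL : roundTo B S d e p ∈ largeVertices B S := by
      rw [← h2]
      exact (hrep.endPixel hSB x).mem_largeVertices hSB
    have h3 := reach_endPixel (Q := Q) x hrepL (by rwa [h2])
    rw [h2] at h3
    refine h3.trans ?_
    rw [← segRep_congr hSB hde.symm hy hp he]
    exact reach_segRep hSB hde.symm hyL
  -- The rounded pixel may lie in the interior of its segment and in a perpendicular segment without
  -- base vertices. Rounding in the other direction as well gives the crossing `z` of the two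
  -- rounded segments, a vertex of the large tilt graph.
  · obtain ⟨hz, hzb, hzd⟩ := roundTo_spec (S := S) hde.symm _ hy
    set z := roundTo B S e d (roundTo B S d e p)
    have hzL : z ∈ largeVertices B S := by
      rw [mem_largeVertices_iff hSB hde, hzd]
      exact ⟨hz, hb, hzb⟩
    have h1 : segRep B S d e p = endPixel B d z := hzd.symm
    rw [h1] at hrepL hQ ⊢
    refine (reach_of_endPixel d hzL hrepL hQ).trans ?_
    have h2 : segRep B S e d p = endPixel B e z := by
      rw [← segRep_congr hSB hde.symm hy hp he, segRep]
    rw [h2, ← segRep_of_mem_largeVertices hSB hde.symm hzL]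
    exact reach_segRep hSB hde.symm hzL

/-- A sink is a base vertex, so its segments are not moved by rounding, and the representative lies
in the sink's own segment. -/
theorem Avail.reach_none (hSB : S ⊆ B) {d e : Dir} (hde : d.Perp e) {p : Pixel} (hp : p ∈ S)
    (h : Avail B S Q d e p) : Reach B S Q (segRep B S d e p) none := by
  have hb : IsBaseVertex B S p := Or.inr (Or.inl hp)
  have hpL := hb.mem_largeVertices hSB
  have hrepL := (hb.endPixel hSB d).mem_largeVertices hSB
  unfold Avail at h
  rw [segRep_of_mem_largeVertices hSB hde hpL] at h ⊢
  refine Relation.ReflTransGen.trans ?_ (_root_.reach_none hp)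
  rcases h with ⟨x, hx, hxp⟩ | hQ
  · have h2 : endPixel B x (endPixel B d p) = p := by
      rcases hx with rfl | rfl
      · rw [hxp, hxp]
      · rw [endPixel_opp_endPixel d _ (hSB hp), hxp]
    have := reach_endPixel (Q := Q) x hrepL (by rwa [h2])
    rwa [h2] at this
  · exact reach_of_endPixel d hpL hrepL hQ

end Base

/-! Arborescences from reachability -/

/-- If all elements of `W` are connected to `r`, then every element other than `r` has a successor
that is closer to `r`. -/
theorem exists_closer {α : Type*} (A : α → α → Prop) (r : α) :
    ∃ (f : α → α) (dist : α → ℕ), ∀ a, a ≠ r → Relation.ReflTransGen A a r →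
      A a (f a) ∧ Relation.ReflTransGen A (f a) r ∧ dist (f a) < dist a := by
  classical
  -- `D n a` is the existence of a walk of exactly `n` steps from `a` to `r`; the successor is taken
  -- on a shortest walk.
  let D : ℕ → α → Prop := fun n =>
    Nat.rec (motive := fun _ => α → Prop) (fun a => a = r) (fun _ D a => ∃ b, A a b ∧ D b) n
  have hD : ∀ n a, D n a → Relation.ReflTransGen A a r := by
    intro n
    induction n with
    | zero => intro a h; rw [show a = r from h]
    | succ n ih => rintro a ⟨b, hb, h⟩; exact .head hb (ih b h)
  have hex : ∀ a, Relation.ReflTransGen A a r → ∃ n, D n a := by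
    intro a har
    induction har using Relation.ReflTransGen.head_induction_on with
    | refl => exact ⟨0, rfl⟩
    | head hab _ ih => obtain ⟨n, hn⟩ := ih; exact ⟨n + 1, _, hab, hn⟩
  have key : ∀ a, ∃ b, a ≠ r → Relation.ReflTransGen A a r →
      A a b ∧ Relation.ReflTransGen A b r ∧ sInf {n | D n b} < sInf {n | D n a} := by
    intro a
    by_cases h : a ≠ r ∧ Relation.ReflTransGen A a r
    · have hmem : D (sInf {n | D n a}) a := Nat.sInf_mem (hex a h.2)
      generalize hn : sInf {n | D n a} = n at hmem
      cases n with
      | zero => exact (h.1 hmem).elim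
      | succ n =>
        obtain ⟨b, hab, hb⟩ := hmem
        refine ⟨b, fun _ _ => ⟨hab, hD n b hb, ?_⟩⟩
        exact Nat.lt_succ_of_le (Nat.sInf_le hb)
    · exact ⟨a, fun h1 h2 => (h ⟨h1, h2⟩).elim⟩
  choose f hf using key
  exact ⟨f, fun a => sInf {n | D n a}, hf⟩

/-- If all vertices of the large tilt graph are connected to the root using only inverse edges that
start in `Q`, there is an arborescence whose weight is at most the cardinality of `Q`. -/
theorem exists_arborescence {B S Q : Finset Pixel}
    (h : ∀ p ∈ largeVertices B S, Reach B S Q p none) :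
    ∃ T, IsArborescence (largeVertices B S) (LargeTiltEdge B S) S T ∧
      ∑ e ∈ T, extWeight (LargeTiltEdge B S) e ≤ Q.card := by
  classical
  set W := largeVertices B S
  obtain ⟨f, dist, hf⟩ := exists_closer (ReachEdge B S Q) none
  have hf' : ∀ p ∈ W, ReachEdge B S Q (some p) (f (some p)) ∧
      dist (f (some p)) < dist (some p) := fun p hp =>
    have := hf (some p) (by simp) (h p hp)
    ⟨this.1, this.2.2⟩
  have hfW : ∀ p ∈ W, ∀ q, f (some p) = some q → q ∈ W := by
    intro p hp q hq
    have := (hf' p hp).1.1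
    rw [hq] at this
    rcases this with h | h
    · exact h.2.1
    · exact h.1.1
  set T : Finset (Option Pixel × Option Pixel) := W.image fun p => (some p, f (some p)) with hT
  have hmem : ∀ a b, (a, b) ∈ T ↔ ∃ p ∈ W, some p = a ∧ f (some p) = b := by
    intro a b
    simp [hT]
  refine ⟨T, ⟨?_, ?_, ?_, ?_⟩, ?_⟩
  · intro a b hab
    obtain ⟨p, hp, rfl, rfl⟩ := (hmem a b).1 hab
    exact (hf' p hp).1.1
  · intro p hp
    refine ⟨f (some p), (hmem _ _).2 ⟨p, hp, rfl, rfl⟩, fun b hb => ?_⟩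
    obtain ⟨p', -, h1, rfl⟩ := (hmem _ b).1 hb
    rw [h1]
  · suffices H : ∀ n, ∀ p ∈ W, dist (some p) = n →
        Relation.ReflTransGen (fun a b => (a, b) ∈ T) (some p) none from
      fun p hp => H _ p hp rfl
    intro n
    induction n using Nat.strong_induction_on with
    | _ n ih =>
      intro p hp hn
      have hpT : (some p, f (some p)) ∈ T := (hmem _ _).2 ⟨p, hp, rfl, rfl⟩
      refine .head hpT ?_
      have hlt := (hf' p hp).2
      cases hq : f (some p) with
      | none => exact .refl
      | some q =>
        rw [hq, hn] at hlt
        exact ih _ hlt q (hfW p hp q hq) rfl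
  · intro a b hab
    obtain ⟨p, hp, rfl, rfl⟩ := (hmem a b).1 hab
    exact ⟨p, hp, rfl⟩
  · rw [hT, Finset.sum_image (by intro a _ b _ hab; simpa using congrArg Prod.fst hab)]
    calc ∑ p ∈ W, extWeight (LargeTiltEdge B S) (some p, f (some p))
        ≤ ∑ p ∈ W, if p ∈ Q then 1 else 0 := by
          refine Finset.sum_le_sum fun p hp => ?_
          have h2 := (hf' p hp).1.2
          cases hq : f (some p) with
          | none => simp [extWeight]
          | some q =>
            have h3 := h2 p q rfl hq
            simp only [extWeight]
            split_ifs with h4 h5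
            · exact le_rfl
            -- An edge of weight one is not a tilt edge, so it has to start in `Q`.
            · exact absurd (h3.resolve_right h5) h4.2
            · simp
            · exact le_rfl
      _ = (W.filter (· ∈ Q)).card := by rw [Finset.card_filter]
      _ ≤ Q.card := Finset.card_le_card fun p hp => (Finset.mem_filter.1 hp).2

theorem exists_isMinArborescence {W : Finset Pixel} {E : Pixel → Pixel → Prop} {S : Finset Pixel}
    {T : Finset (Option Pixel × Option Pixel)} (h : IsArborescence W E S T) :
    ∃ T', IsMinArborescence W E S T' := by
  obtain ⟨T', hT', hmin⟩ := WellFounded.has_min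
    (InvImage.wf (fun T => ∑ e ∈ T, extWeight E e) Nat.lt_wfRel.wf) {T | IsArborescence W E S T}
    ⟨T, h⟩
  exact ⟨T', hT', fun T'' h'' => not_lt.1 (hmin T'' h'')⟩

/-! Scaled boards -/

/-- The pixel that contains a sub-pixel. -/
def coarse (k : ℕ) (x : Pixel) : Pixel := (x.1 / k, x.2 / k)

theorem mem_block_iff {k : ℕ} (hk : 0 < k) {p x : Pixel} : x ∈ block k p ↔ coarse k x = p := by
  have hk' : (0 : ℤ) < k := by exact_mod_cast hk
  simp only [block, coarse, Finset.mem_image, Finset.mem_product, Finset.mem_range]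
  constructor
  · rintro ⟨⟨i, j⟩, ⟨hi, hj⟩, rfl⟩
    have h1 : ((i : ℤ)) / k = 0 := Int.ediv_eq_zero_of_lt (by positivity) (by exact_mod_cast hi)
    have h2 : ((j : ℤ)) / k = 0 := Int.ediv_eq_zero_of_lt (by positivity) (by exact_mod_cast hj)
    ext
    · change ((k : ℤ) * p.1 + i) / k = p.1
      rw [add_comm, Int.add_mul_ediv_left _ _ hk'.ne', h1, zero_add]
    · change ((k : ℤ) * p.2 + j) / k = p.2
      rw [add_comm, Int.add_mul_ediv_left _ _ hk'.ne', h2, zero_add]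
  · rintro rfl
    have a1 := Int.emod_nonneg x.1 hk'.ne'
    have a2 := Int.emod_nonneg x.2 hk'.ne'
    have b1 := Int.emod_lt_of_pos x.1 hk'
    have b2 := Int.emod_lt_of_pos x.2 hk'
    refine ⟨((x.1 % k).toNat, (x.2 % k).toNat), ⟨by omega, by omega⟩, ?_⟩
    ext
    · simp only [Int.toNat_of_nonneg a1]; exact Int.mul_ediv_add_emod _ _
    · simp only [Int.toNat_of_nonneg a2]; exact Int.mul_ediv_add_emod _ _

theorem exists_coarse_eq {k : ℕ} (hk : 0 < k) (p : Pixel) : ∃ x, coarse k x = p :=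
  ⟨(k * p.1, k * p.2), by
    have : (k : ℤ) ≠ 0 := by exact_mod_cast hk.ne'
    exact Prod.ext (Int.mul_ediv_cancel_left _ this) (Int.mul_ediv_cancel_left _ this)⟩

theorem mem_scaledBoard_iff {k : ℕ} (hk : 0 < k) {B : Finset Pixel} {x : Pixel} :
    x ∈ scaledBoard k B ↔ coarse k x ∈ B := by
  simp [scaledBoard, mem_block_iff hk]

theorem coarse_add_vec {k : ℕ} (hk : 0 < k) (d : Dir) (x : Pixel) :
    coarse k (x + d.vec) = coarse k x ∨ coarse k (x + d.vec) = coarse k x + d.vec := by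
  have hk' : (0 : ℤ) < k := by exact_mod_cast hk
  have up : ∀ a : ℤ, (a + 1) / k = a / k ∨ (a + 1) / k = a / k + 1 := by
    intro a
    have h1 : a / k ≤ (a + 1) / k := Int.ediv_le_ediv hk' (by omega)
    have h2 : (a + 1) / k ≤ (a + k) / k := Int.ediv_le_ediv hk' (by omega)
    have h3 : (a + k) / k = a / k + 1 := by
      simpa [Int.ediv_self hk'.ne'] using Int.add_mul_ediv_left a 1 hk'.ne'
    rw [h3] at h2
    omega
  have down : ∀ a : ℤ, (a + -1) / k = a / k ∨ (a + -1) / k = a / k + -1 := by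
    intro a
    have := up (a + -1)
    rw [neg_add_cancel_right] at this
    omega
  cases d <;> simp only [coarse, Dir.vec, Prod.ext_iff, Prod.fst_add, Prod.snd_add, add_zero,
    true_and, and_true, up, down]

section Scaled

variable {k : ℕ} {B S O Q : Finset Pixel}

/-- The pixel of a sub-pixel that comes to rest: it lies in the same segment of `B`, and it is the
end of this segment unless the sub-pixel is stopped by an obstacle. -/
theorem coarse_endPixel (hk : 0 < k) {d x : Dir} (hx : x = d ∨ x = d.opp) :
    ∀ a ∈ scaledBoard k B \ O,
      endPixel B d (coarse k (endPixel (scaledBoard k B \ O) x a)) =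
        endPixel B d (coarse k a) ∧
      (endPixel B x (coarse k (endPixel (scaledBoard k B \ O) x a)) =
          coarse k (endPixel (scaledBoard k B \ O) x a) ∨
        ∃ o ∈ O, coarse k o ∈ B ∧ endPixel B d (coarse k o) = endPixel B d (coarse k a)) := by
  have key : ∀ a, coarse k a ∈ B → coarse k (a + x.vec) ∈ B →
      endPixel B d (coarse k (a + x.vec)) = endPixel B d (coarse k a) := by
    intro a ha hax
    rcases coarse_add_vec hk x a with h | h
    · rw [h]
    · rw [h] at hax ⊢
      exact endPixel_add_of_parallel hx ha hax
  refine segment_induction x (fun a ha hax => ?_) fun a ha hax ih => ?_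
  · have haB := (mem_scaledBoard_iff hk).1 (Finset.mem_sdiff.1 ha).1
    rw [endPixel_of_notMem hax]
    refine ⟨rfl, ?_⟩
    by_cases hB : coarse k (a + x.vec) ∈ B
    · right
      -- The next sub-pixel lies in the scaled board but stops the particle, so it is an obstacle.
      refine ⟨a + x.vec, ?_, hB, key a haB hB⟩
      by_contra hO
      exact hax (Finset.mem_sdiff.2 ⟨(mem_scaledBoard_iff hk).2 hB, hO⟩)
    · left
      rcases coarse_add_vec hk x a with h | h
      · rw [h] at hB
        exact (hB haB).elim
      · rw [h] at hB
        exact endPixel_of_notMem hB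
  · have haB := (mem_scaledBoard_iff hk).1 (Finset.mem_sdiff.1 ha).1
    have haxB := (mem_scaledBoard_iff hk).1 (Finset.mem_sdiff.1 hax).1
    rwa [endPixel_of_mem hax, key a haB haxB] at ih

/-- Starting from a sub-pixel that reaches a sink, turn where the sub-pixel is available. -/
theorem reach_of_path (hk : 0 < k) (hSB : S ⊆ B) {d e : Dir} (hde : d.Perp e)
    (hQd : ∀ o ∈ O, segRep B S d e (coarse k o) ∈ Q)
    (hQe : ∀ o ∈ O, segRep B S e d (coarse k o) ∈ Q) {x z : Pixel}
    (h : Relation.ReflTransGen (fun a b => a ∈ scaledBoard k B \ O ∧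
      ∃ x : Dir, b = endPixel (scaledBoard k B \ O) x a) x z) (hz : coarse k z ∈ S) :
    (Avail B S Q d e (coarse k x) → Reach B S Q (segRep B S d e (coarse k x)) none) ∧
      (Avail B S Q e d (coarse k x) → Reach B S Q (segRep B S e d (coarse k x)) none) := by
  induction h using Relation.ReflTransGen.head_induction_on with
  | refl => exact ⟨fun h => h.reach_none hSB hde hz, fun h => h.reach_none hSB hde.symm hz⟩
  | head hab _ ih =>
    rename_i a b _
    obtain ⟨ha, x, rfl⟩ := hab
    have haB := (mem_scaledBoard_iff hk).1 (Finset.mem_sdiff.1 ha).1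
    have hbB := (mem_scaledBoard_iff hk).1 (Finset.mem_sdiff.1 (endPixel_mem x a ha)).1
    -- A move along `d` keeps the `d`-segment and stops at an available pixel of it. Hence its
    -- representative reaches the root whether or not `a` is available, and the perpendicular one
    -- does so by turning at `a`.
    have main : ∀ d e : Dir, d.Perp e → (x = d ∨ x = d.opp) →
        (∀ o ∈ O, segRep B S d e (coarse k o) ∈ Q) →
        (Avail B S Q d e (coarse k (endPixel (scaledBoard k B \ O) x a)) →
          Reach B S Q (segRep B S d e (coarse k (endPixel (scaledBoard k B \ O) x a))) none) →
        Reach B S Q (segRep B S d e (coarse k a)) none ∧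
          (Avail B S Q e d (coarse k a) → Reach B S Q (segRep B S e d (coarse k a)) none) := by
      intro d e hde hx hQ hb
      obtain ⟨h1, h2⟩ := coarse_endPixel (B := B) (O := O) hk hx a ha
      have h3 := segRep_congr hSB hde hbB haB h1
      rw [h3] at hb
      have h4 : Reach B S Q (segRep B S d e (coarse k a)) none := by
        refine hb ?_
        rcases h2 with h2 | ⟨o, ho, hoB, h2⟩
        · exact Or.inl ⟨x, hx, h2⟩
        · right
          rw [h3, ← segRep_congr hSB hde hoB haB h2]
          exact hQ o ho
      exact ⟨h4, fun h => (h.reach_perp hSB hde.symm haB).trans h4⟩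
    have hcases := d.eq_or_opp_or_perp x
    by_cases hx : x = d ∨ x = d.opp
    · obtain ⟨h1, h2⟩ := main d e hde hx hQd ih.1
      exact ⟨fun _ => h1, h2⟩
    · have hx' : x = e ∨ x = e.opp := hde.eq_or_opp (by tauto)
      obtain ⟨h1, h2⟩ := main e d hde.symm hx' hQe ih.2
      exact ⟨h2, fun _ => h1⟩

/-- All segments are connected to the root, if inverse edges can be used in the segments with
obstacles. -/
theorem reach_segRep_none (hk : 0 < k) (hSB : S ⊆ B) (hS : EveryRegionHasSink B S)
    (hO : IsSolution k B S O) {d e : Dir} (hde : d.Perp e)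
    (hQd : ∀ o ∈ O, segRep B S d e (coarse k o) ∈ Q)
    (hQe : ∀ o ∈ O, segRep B S e d (coarse k o) ∈ Q) (p : Pixel) (hp : p ∈ B) :
    Reach B S Q (segRep B S d e p) none ∧ Reach B S Q (segRep B S e d p) none := by
  have free : ∀ x ∈ scaledBoard k B \ O,
      (Avail B S Q d e (coarse k x) → Reach B S Q (segRep B S d e (coarse k x)) none) ∧
      (Avail B S Q e d (coarse k x) → Reach B S Q (segRep B S e d (coarse k x)) none) := by
    intro x hx
    obtain ⟨z, hz, y, hy, hr⟩ := hO.2.exists_path hx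
    obtain ⟨s, hs, rfl⟩ := Finset.mem_image.1 hz
    refine reach_of_path hk hSB hde hQd hQe hr ?_
    rwa [(mem_block_iff hk).1 hy]
  have mem : ∀ x, coarse k x ∈ B → x ∉ O → x ∈ scaledBoard k B \ O := fun x hx hxO =>
    Finset.mem_sdiff.2 ⟨(mem_scaledBoard_iff hk).2 hx, hxO⟩
  have clear : ∀ d e : Dir, d.Perp e → (∀ o ∈ O, segRep B S d e (coarse k o) ∈ Q) →
      (∀ x ∈ scaledBoard k B \ O, Avail B S Q d e (coarse k x) →
        Reach B S Q (segRep B S d e (coarse k x)) none) →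
      ∀ p ∈ B, segRep B S d e p ∉ Q → Reach B S Q (segRep B S d e p) none := by
    intro d e hde hQ hfree p hp hpQ
    obtain ⟨x, hx⟩ := exists_coarse_eq hk (endPixel B d p)
    have hq := endPixel_mem d p hp
    have hqp := endPixel_endPixel d hp
    have heq := segRep_congr hSB hde (S := S) hq hp hqp
    -- A representative outside `Q` means that the segment has no obstacles. The particle can then
    -- be started in its end pixel, which is available.
    have hxO : x ∉ O := fun hxO => hpQ (by rw [← heq, ← hx]; exact hQ x hxO)
    have := hfree x (mem x (hx ▸ hq) hxO)
    rw [hx, heq] at this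
    exact this (Or.inl ⟨d, Or.inl rfl, hqp⟩)
  have nonfull : ∀ p ∈ B, (∃ x, coarse k x = p ∧ x ∉ O) →
      Reach B S Q (segRep B S d e p) none ∧ Reach B S Q (segRep B S e d p) none := by
    rintro p hp ⟨x, rfl, hxO⟩
    have hf := free x (mem x hp hxO)
    constructor
    · by_cases h : segRep B S d e (coarse k x) ∈ Q
      · exact hf.1 (Or.inr h)
      · exact clear d e hde hQd (fun x hx => (free x hx).1) _ hp h
    · by_cases h : segRep B S e d (coarse k x) ∈ Q
      · exact hf.2 (Or.inr h)
      · exact clear e d hde.symm hQe (fun x hx => (free x hx).2) _ hp h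
  have full : ∀ p : Pixel, (¬ ∃ x, coarse k x = p ∧ x ∉ O) →
      segRep B S d e p ∈ Q ∧ segRep B S e d p ∈ Q := by
    intro p h
    obtain ⟨x, rfl⟩ := exists_coarse_eq hk p
    have hx : x ∈ O := by
      by_contra hx
      exact h ⟨x, rfl, hx⟩
    exact ⟨hQd x hx, hQe x hx⟩
  obtain ⟨s, hsS, hsR⟩ := hS ((boardGraph B).connectedComponentMk ⟨p, hp⟩)
  have hconn : (boardGraph B).Reachable ⟨p, hp⟩ s :=
    (SimpleGraph.ConnectedComponent.exact hsR).symm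
  rw [SimpleGraph.reachable_iff_reflTransGen] at hconn
  -- Walk towards a sink of the region. A covered pixel shares one segment with its successor and
  -- can turn into that segment from the other one.
  suffices H : ∀ q : {p // p ∈ B}, Relation.ReflTransGen (boardGraph B).Adj q s →
      Reach B S Q (segRep B S d e q) none ∧ Reach B S Q (segRep B S e d q) none from
    H ⟨p, hp⟩ hconn
  intro q hq
  induction hq using Relation.ReflTransGen.head_induction_on with
  | refl =>
    by_cases h : ∃ x, coarse k x = s.1 ∧ x ∉ O
    · exact nonfull _ s.2 h
    · obtain ⟨h1, h2⟩ := full _ h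
      exact ⟨Avail.reach_none hSB hde hsS (Or.inr h1),
        Avail.reach_none hSB hde.symm hsS (Or.inr h2)⟩
  | head hab _ ih =>
    rename_i a b _
    by_cases h : ∃ x, coarse k x = a.1 ∧ x ∉ O
    · exact nonfull _ a.2 h
    · obtain ⟨h1, h2⟩ := full _ h
      have hstep : ∃ x : Dir, b.1 = a.1 + x.vec := by
        rw [boardGraph, SimpleGraph.fromRel_adj] at hab
        rcases hab.2 with h | ⟨x, hx⟩
        · exact h
        · exact ⟨x.opp, by rw [hx, Dir.vec_opp]; abel⟩
      obtain ⟨x, hx⟩ := hstep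
      have hb : a.1 + x.vec ∈ B := hx ▸ b.2
      have hcases := d.eq_or_opp_or_perp x
      by_cases hxd : x = d ∨ x = d.opp
      · have h3 := segRep_congr hSB hde (S := S) hb a.2 (endPixel_add_of_parallel hxd a.2 hb)
        rw [← hx] at h3
        have h4 := h3 ▸ ih.1
        exact ⟨h4, (Avail.reach_perp hSB hde.symm a.2 (Or.inr h2)).trans h4⟩
      · have hxe : x = e ∨ x = e.opp := hde.eq_or_opp (by tauto)
        have h3 := segRep_congr hSB hde.symm (S := S) hb a.2
          (endPixel_add_of_parallel hxe a.2 hb)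
        rw [← hx] at h3
        have h4 := h3 ▸ ih.2
        exact ⟨(Avail.reach_perp hSB hde a.2 (Or.inr h1)).trans h4, h4⟩

/-- Every solution gives an arborescence of at most twice its cardinality. -/
theorem exists_arborescence_of_isSolution (hk : 0 < k) (hSB : S ⊆ B)
    (hS : EveryRegionHasSink B S) (hO : IsSolution k B S O) :
    ∃ T, IsArborescence (largeVertices B S) (LargeTiltEdge B S) S T ∧
      ∑ e ∈ T, extWeight (LargeTiltEdge B S) e ≤ 2 * O.card := by
  classical
  have hde : Dir.Perp .right .up := trivial
  -- Row segments are represented by right ends after rounding upwards, column segments by top ends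
  -- after rounding to the right; the choice of sides is arbitrary.
  set Q : Finset Pixel := (O.image fun o => segRep B S .right .up (coarse k o)) ∪
    O.image fun o => segRep B S .up .right (coarse k o)
  have hQcard : Q.card ≤ 2 * O.card := by
    rw [two_mul]
    exact (Finset.card_union_le _ _).trans (add_le_add Finset.card_image_le Finset.card_image_le)
  obtain ⟨T, hT, hw⟩ := exists_arborescence (Q := Q) fun p hp =>
    (reach_segRep hSB hde hp).trans
      (reach_segRep_none hk hSB hS hO hde
        (fun o ho => Finset.mem_union_left _ (Finset.mem_image.2 ⟨o, ho, rfl⟩))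
        (fun o ho => Finset.mem_union_right _ (Finset.mem_image.2 ⟨o, ho, rfl⟩)) p
        ((mem_largeVertices_iff hSB hde).1 hp).1).1
  exact ⟨T, hT, hw.trans hQcard⟩

end Scaled

/-! The output of the algorithm -/

theorem card_turnGadget_le (k : ℕ) (q p : Pixel) : (turnGadget k q p).card ≤ 3 := by
  unfold turnGadget
  split_ifs <;> exact Finset.card_image_le.trans Finset.card_le_three

open scoped Classical in
/-- The union of the turn gadgets determined by the inverse edges in `T`. -/
noncomputable def gadgetUnion (k : ℕ) (E : Pixel → Pixel → Prop)
    (T : Finset (Option Pixel × Option Pixel)) : Finset Pixel :=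
  T.biUnion fun
    | (some q, some p) => if IsInverseEdge E q p then turnGadget k q p else ∅
    | _ => ∅

theorem mem_gadgetUnion {k : ℕ} {E : Pixel → Pixel → Prop}
    {T : Finset (Option Pixel × Option Pixel)} {x : Pixel} :
    x ∈ gadgetUnion k E T ↔ ∃ q p : Pixel, (some q, some p) ∈ T ∧ IsInverseEdge E q p ∧
      x ∈ turnGadget k q p := by
  classical
  rw [gadgetUnion, Finset.mem_biUnion]
  constructor
  · rintro ⟨⟨_ | q, _ | p⟩, hT, hx⟩
    · simp at hx
    · simp at hx
    · simp at hx
    · by_cases h : IsInverseEdge E q p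
      · exact ⟨q, p, hT, h, by simpa [h] using hx⟩
      · simp [h] at hx
  · rintro ⟨q, p, hT, h, hx⟩
    exact ⟨_, hT, by simpa [h] using hx⟩

theorem card_gadgetUnion_le (k : ℕ) (E : Pixel → Pixel → Prop)
    (T : Finset (Option Pixel × Option Pixel)) :
    (gadgetUnion k E T).card ≤ 3 * ∑ e ∈ T, extWeight E e := by
  classical
  rw [gadgetUnion, Finset.mul_sum]
  refine Finset.card_biUnion_le.trans (Finset.sum_le_sum ?_)
  rintro ⟨_ | q, _ | p⟩ -
  · simp
  · simp
  · simp
  · by_cases h : IsInverseEdge E q p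
    · simpa [h, extWeight] using card_turnGadget_le k q p
    · simp [h]

theorem mainTheorem3 (k : ℕ) (hk : 3 < k) (B S : Finset Pixel) (hSB : S ⊆ B)
    (hS : EveryRegionHasSink B S) :
    (∃ O : Finset Pixel, IsAlgorithmOutput k B S O) ∧
      ∀ O : Finset Pixel, IsAlgorithmOutput k B S O →
        ∀ Oopt : Finset Pixel, IsOptimumSolution k B S Oopt → O.card ≤ 6 * Oopt.card := by
  have hk0 : 0 < k := by omega
  constructor
  · obtain ⟨O, hO⟩ := exists_isOptimumSolution k B S
    obtain ⟨T, hT, -⟩ := exists_arborescence_of_isSolution hk0 hSB hS hO.1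
    obtain ⟨T', hT'⟩ := exists_isMinArborescence hT
    exact ⟨gadgetUnion k (LargeTiltEdge B S) T', T', hT', fun x => mem_gadgetUnion⟩
  · rintro O ⟨T, hT, hO⟩ Oopt hopt
    obtain ⟨T', hT', hw⟩ := exists_arborescence_of_isSolution hk0 hSB hS hopt.1
    have hOT : O = gadgetUnion k (LargeTiltEdge B S) T := by
      ext x
      rw [hO, mem_gadgetUnion]
    have h1 := card_gadgetUnion_le k (LargeTiltEdge B S) T
    have h2 := hT.2 T' hT'
    rw [hOT]
    omega
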